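/- Let $p$ be a prime and let $S$ be a regular ring of characteristic $p$ (a Noetherian ring containing $\mathbb{F}_p$, all of whose localizations at primes are regular local rings; not necessarily local) that is $F$-finite, i.e. $F_*S$ is a finite $S$-module, where for a ring $A$ of characteristic $p$ and $e \ge 0$, $F^e_*A$ denotes $A$ viewed as an $A$-module via the $e$-th iterate of Frobenius. Let $I \subsetneq S$ be an ideal and $R = S/I$. A graded system of ideals $\mathfrak{a}_\bullet$ of a ring $A$ is a family of ideals $(\mathfrak{a}_i)_{i \ge 0}$ with $\mathfrak{a}_i\mathfrak{a}_j \subseteq \mathfrak{a}_{i+j}$; $(A,\mathfrak{a}_\bullet)$ is a pair if $A$ is reduced, $\mathfrak{a}_0 = A$, and every $\mathfrak{a}_i$ contains an element lying in no minimal prime of $A$. If $(A,\mathfrak{a}_\bullet)$ is a pair with $A$ an $F$-finite ring of characteristic $p$, an ideal $K \subseteq A$ is uniformly $(\mathfrak{a}_\bullet,F)$-compatible if for every $e > 0$, every $a \in \mathfrak{a}_{p^e-1}$ and every $A$-linear map $\phi : F^e_*A \to A$ we have $\phi(F^e_*(aK)) \subseteq K$. For an ideal $K \subseteq S$, $K^{[p^e]}$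 denotes the ideal generated by the $p^e$-th powers of the elements of $K$. Let $\mathfrak{a}_\bullet$ be a graded system of ideals of $S$ with images $\overline{\mathfrak{a}}_i = \mathfrak{a}_i R$, such that $(S,\mathfrak{a}_\bullet)$ and $(R,\overline{\mathfrak{a}}_\bullet)$ are both pairs, and let $J \subseteq S$ be an ideal containing $I$, with image $\overline{J} = J/I$ in $R$. Then $\overline{J}$ is uniformly $(\overline{\mathfrak{a}}_\bullet,F)$-compatible if and only if for all $e \ge 0$ and all $a \in \mathfrak{a}_{p^e-1}$ \[ a\,(I^{[p^e]} : I) \subseteq (J^{[p^e]} : J). \] Equivalently, $\overline{J}$ is uniformly $(\overline{\mathfrak{a}}_\bullet,F)$-compatible if and only if for all $e \ge 0$ \[ \mathfrak{a}_{p^e-1}\,(I^{[p^e]} : I) \subseteq (J^{[p^e]} : J). \] -/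

import Mathlib

/-- `F^e_* R`: the ring `R` of characteristic `p`, regarded as an `R`-module through the `e`-th
iterate of Frobenius. -/
def FrobPush (p e : ℕ) (R : Type*) : Type _ := R

namespace FrobPush

variable {p e : ℕ} {R : Type*} [CommRing R]

instance : CommRing (FrobPush p e R) := inferInstanceAs (CommRing R)

/-- The identity map `x ↦ F^e_* x`. -/
def of (p e : ℕ) {R : Type*} [CommRing R] : R ≃+* FrobPush p e R := RingEquiv.refl R

/-- `r • F^e_* x = F^e_* (r ^ p ^ e * x)`. -/
noncomputable instance [Fact p.Prime] [CharP R p] : Module R (FrobPush p e R) :=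
  Module.compHom (FrobPush p e R) ((of p e).toRingHom.comp (iterateFrobenius R p e))

theorem smul_of [Fact p.Prime] [CharP R p] (r x : R) :
    r • of p e x = of p e (r ^ p ^ e * x) := rfl

end FrobPush

/-- A ring `R` of characteristic `p` is `F`-finite if `F_* R` is a finite `R`-module. -/
def IsFFinite (p : ℕ) (R : Type*) [CommRing R] [Fact p.Prime] [CharP R p] : Prop :=
  Module.Finite R (FrobPush p 1 R)

/-- A graded system of ideals: ideals `𝔞 i`, `i ≥ 0`, with `𝔞 i * 𝔞 j ⊆ 𝔞 (i + j)`. -/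
structure GradedSystem (R : Type*) [CommRing R] where
  ideal : ℕ → Ideal R
  mul_le : ∀ i j, ideal i * ideal j ≤ ideal (i + j)

namespace GradedSystem

variable {R : Type*} [CommRing R]

/-- The graded system of extended ideals `𝔞 i · T` for a ring homomorphism `R → T`. -/
def map {T : Type*} [CommRing T] (𝔞 : GradedSystem R) (f : R →+* T) : GradedSystem T where
  ideal i := (𝔞.ideal i).map f
  mul_le i j := by
    rw [← Ideal.map_mul]
    exact Ideal.map_mono (𝔞.mul_le i j)

/-- `(R, 𝔞)` is a pair: `R` is reduced, `𝔞 0 = R`, and each `𝔞 i` contains an element that lies in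
no minimal prime of `R`. -/
structure IsPair (𝔞 : GradedSystem R) : Prop where
  isReduced : IsReduced R
  ideal_zero : 𝔞.ideal 0 = ⊤
  exists_mem : ∀ i, ∃ x ∈ 𝔞.ideal i, ∀ P ∈ minimalPrimes R, x ∉ P

end GradedSystem

/-- The ideal `K` is uniformly `(𝔞, F)`-compatible: for all `e > 0`, all `a ∈ 𝔞 (p ^ e - 1)` and all
`R`-linear maps `φ : F^e_* R → R` one has `φ (F^e_* (a K)) ⊆ K`. -/
def IsUniformlyFCompatible (p : ℕ) {R : Type*} [CommRing R] [Fact p.Prime] [CharP R p]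
    (𝔞 : GradedSystem R) (K : Ideal R) : Prop :=
  ∀ e : ℕ, 0 < e → ∀ a ∈ 𝔞.ideal (p ^ e - 1), ∀ φ : FrobPush p e R →ₗ[R] R,
    ∀ x ∈ K, φ (FrobPush.of p e (a * x)) ∈ K

/-- The Frobenius power `I^[p^e]`: the ideal generated by the elements `x ^ p ^ e`, `x ∈ I`. -/
def frobPower (p e : ℕ) {R : Type*} [CommRing R] (I : Ideal R) : Ideal R :=
  Ideal.span ((fun x : R => x ^ p ^ e) '' (I : Set R))

/-! This is Fedder's criterion, proved one `e` and one `a` at a time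
(`forall_apply_mem_map_iff_span_mul_colon_le`). Write q = p^e. By Kunz, F^e_*S is finite projective
over S (`IsRegularRing.projective_frobPush`). So functionals on F^e_*(S/I) are exactly those induced
by functionals ψ on F^e_*S preserving I, and a dual basis shows that x ∈ L^[q] iff ψ(x) ∈ L for all
ψ. If s ∈ (I^[q] : I), every ψ(s·) preserves I and hence descends; compatibility puts ψ(asj) in J
for all ψ and all j ∈ J, so as ∈ (J^[q] : J). The converse needs each ψ to be a multiple of one Φ.
This holds near each maximal ideal m (`exists_smul_eq_mulForm`): S/m^[q] has a one-dimensional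
essential socle, so a Φ nonzero on it gives a perfect pairing modulo m, and Nakayama yields r ∉ m
with rψ = Φ(b·) for every ψ, where b depends on ψ. If ψ preserves I, then r^q b ∈ (I^[q] : I), and
the inclusion of colon ideals controls ψ on aJ up to a power of r. -/

/-! ### Regular local rings: a regular sequence generating the maximal ideal. -/

open IsLocalRing RingTheory.Sequence in
/-- In a Noetherian local ring of positive dimension some element of the maximal ideal lies neither
in its square nor in a minimal prime. -/
theorem IsLocalRing.exists_mem_notMem_sq_notMem_minimalPrimes {R : Type*} [CommRing R]
    [IsLocalRing R] [IsNoetherianRing R] (h : 0 < ringKrullDim R) :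
    ∃ x ∈ maximalIdeal R, x ∉ maximalIdeal R ^ 2 ∧ ∀ P ∈ minimalPrimes R, x ∉ P := by
  have hfield : maximalIdeal R ≠ ⊥ := fun h0 ↦
    h.ne' (ringKrullDim_eq_zero_of_isField (isField_iff_maximalIdeal_eq.mpr h0))
  by_contra! hc
  have hsub : (maximalIdeal R : Set R) ⊆
      ⋃ P ∈ insert (maximalIdeal R ^ 2) (minimalPrimes R), (P : Set R) := by
    intro x hx
    by_cases hx2 : x ∈ maximalIdeal R ^ 2
    · exact Set.mem_biUnion (Set.mem_insert _ _) hx2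
    · obtain ⟨P, hP, hxP⟩ := hc x hx hx2
      exact Set.mem_biUnion (Set.mem_insert_of_mem _ hP) hxP
  -- Prime avoidance tolerates two non-prime members; `maximalIdeal R ^ 2` fills both slots.
  rw [Ideal.subset_union_prime_finite
    ((minimalPrimes.finite_of_isNoetherianRing R).insert _) (maximalIdeal R ^ 2)
    (maximalIdeal R ^ 2)] at hsub
  · obtain ⟨P, hP | hP, hle⟩ := hsub
    · subst hP
      refine hfield (Submodule.eq_bot_of_le_smul_of_le_jacobson_bot (maximalIdeal R) _
        (IsNoetherian.noetherian _) ?_ (maximalIdeal_le_jacobson _))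
      rwa [smul_eq_mul, ← pow_two]
    · have := hP.1.1
      have hPm : P = maximalIdeal R := le_antisymm (le_maximalIdeal this.ne_top) hle
      rw [hPm, ← Ideal.height_eq_zero_iff] at hP
      rw [← maximalIdeal_height_eq_ringKrullDim, hP] at h
      exact lt_irrefl _ h
  · intro P hP hne _
    exact (hP.resolve_left hne).1.1

/-- An element of `m \ m ^ 2` can replace one element of a generating set of the maximal ideal `m`. -/
theorem IsLocalRing.exists_mem_span_sup_span_erase_eq {R : Type*} [CommRing R] [DecidableEq R]
    [IsLocalRing R] {s : Finset R} (hs : Ideal.span (s : Set R) = maximalIdeal R) {x : R}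
    (hx : x ∈ maximalIdeal R) (hx2 : x ∉ maximalIdeal R ^ 2) :
    ∃ y ∈ s, Ideal.span {x} ⊔ Ideal.span (s.erase y : Set R) = maximalIdeal R := by
  have hsm : ∀ z ∈ s, z ∈ maximalIdeal R := fun z hz ↦ hs ▸ Ideal.subset_span hz
  rw [← hs, Ideal.span, Submodule.mem_span_finset] at hx
  obtain ⟨f, -, hf⟩ := hx
  obtain ⟨y, hy, hfy⟩ : ∃ y ∈ s, f y ∉ maximalIdeal R := by
    by_contra! hc
    refine hx2 (hf ▸ Ideal.sum_mem _ fun z hz ↦ ?_)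
    rw [pow_two]
    exact Ideal.mul_mem_mul (hc z hz) (hsm z hz)
  refine ⟨y, hy, le_antisymm (sup_le ?_ ?_) ?_⟩
  · rw [Ideal.span_singleton_le_iff_mem, ← hf]
    exact Ideal.sum_mem _ fun z hz ↦ Ideal.mul_mem_left _ _ (hsm z hz)
  · exact Ideal.span_le.mpr fun z hz ↦ hsm z (Finset.mem_of_mem_erase hz)
  · rw [← hs, Ideal.span_le]
    intro z hz
    by_cases hzy : z = y
    · subst hzy
      have hu : IsUnit (f z) := notMem_maximalIdeal.mp hfy
      refine (Ideal.unit_mul_mem_iff_mem _ hu).mp ?_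
      have : f z * z = x - ∑ a ∈ s.erase z, f a * a := by
        rw [← hf, ← Finset.add_sum_erase s _ hz]; simp
      rw [this]
      refine Ideal.sub_mem _ (Ideal.mem_sup_left (Ideal.mem_span_singleton_self x))
        (Ideal.mem_sup_right (Ideal.sum_mem _ fun a ha ↦ Ideal.mul_mem_left _ _
          (Ideal.subset_span ha)))
    · exact Ideal.mem_sup_right (Ideal.subset_span (by simp [hzy, hz] : z ∈ (s.erase y : Set R)))

open IsLocalRing in
theorem IsLocalRing.span_singleton_sup_eq_maximalIdeal_iff {R : Type*} [CommRing R]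
    [IsLocalRing R] {x : R} [IsLocalRing (R ⧸ Ideal.span {x})] (K : Ideal R) :
    Ideal.span {x} ⊔ K = maximalIdeal R ↔
      K.map (Ideal.Quotient.mk (Ideal.span {x})) = maximalIdeal _ := by
  have hsurj := Ideal.Quotient.mk_surjective (I := Ideal.span {x})
  have := IsLocalHom.of_surjective _ hsurj
  rw [← (Ideal.comap_injective_of_surjective _ hsurj).eq_iff,
    maximalIdeal_comap, Ideal.comap_map_of_surjective' _ hsurj, Ideal.mk_ker, sup_comm]

/-- A Noetherian local ring `R` is a domain if `R ⧸ (x)` is one and `x ∈ m` lies in no minimal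
prime. -/
theorem IsLocalRing.isDomain_of_isDomain_quotient_span_singleton {R : Type*} [CommRing R]
    [IsLocalRing R] [IsNoetherianRing R] {x : R} (hx : x ∈ maximalIdeal R)
    (hmin : ∀ P ∈ minimalPrimes R, x ∉ P) [IsDomain (R ⧸ Ideal.span {x})] : IsDomain R := by
  have : (Ideal.span {x}).IsPrime := (Ideal.Quotient.isDomain_iff_prime _).mp inferInstance
  obtain ⟨P, hP, hle⟩ := Ideal.exists_minimalPrimes_le (bot_le : ⊥ ≤ Ideal.span {x})
  have hPp := hP.1.1
  have : P = ⊥ := by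
    refine Submodule.eq_bot_of_le_smul_of_le_jacobson_bot (maximalIdeal R) _
        (IsNoetherian.noetherian _) (fun y hy ↦ ?_) (maximalIdeal_le_jacobson _)
    obtain ⟨r, rfl⟩ := Ideal.mem_span_singleton'.mp (hle hy)
    rw [mul_comm]
    exact Submodule.smul_mem_smul hx ((hPp.mem_or_mem hy).resolve_right (hmin P hP))
  rw [this] at hPp
  exact IsDomain.of_bot_isPrime R

-- Induct by killing x ∈ m \ m² outside the minimal primes: the number of generators drops, the
-- dimension by at most one. Stating the hypotheses as inequalities lets them pass to R/(x). The two
-- conclusions are proved together because x is a nonzerodivisor only once R is known to be a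
-- domain, which is inherited from R/(x).
open IsLocalRing RingTheory.Sequence in
theorem IsLocalRing.isDomain_and_exists_isWeaklyRegular_of_card_le (n : ℕ) :
    ∀ {R : Type*} [CommRing R] [IsLocalRing R] [IsNoetherianRing R] (s : Finset R),
      Ideal.span (s : Set R) = maximalIdeal R → s.card ≤ n → (n : WithBot ℕ∞) ≤ ringKrullDim R →
      IsDomain R ∧ ∃ rs : List R, IsWeaklyRegular R rs ∧ Ideal.ofList rs = maximalIdeal R := by
  classical
  induction n with
  | zero =>
    intro R _ _ _ s hs hcard _
    obtain rfl : s = ∅ := by simpa using hcard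
    have h0 : maximalIdeal R = ⊥ := by rw [← hs]; simp
    exact ⟨(isField_iff_maximalIdeal_eq.mpr h0).isDomain, [], .nil _ _, by simp [h0]⟩
  | succ n ih =>
    intro R _ _ _ s hs hcard hdim
    obtain ⟨x, hx, hx2, hxmin⟩ := exists_mem_notMem_sq_notMem_minimalPrimes
      (lt_of_lt_of_le (by exact_mod_cast n.succ_pos) hdim)
    obtain ⟨y, hy, hsup⟩ := exists_mem_span_sup_span_erase_eq hs hx hx2
    have hsurj := Ideal.Quotient.mk_surjective (I := Ideal.span {x})
    have : Nontrivial (R ⧸ Ideal.span {x}) :=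
      Ideal.Quotient.nontrivial_iff.mpr (ne_top_of_le_ne_top (maximalIdeal.isMaximal R).ne_top
        ((Ideal.span_singleton_le_iff_mem _).mpr hx))
    have : IsLocalRing (R ⧸ Ideal.span {x}) := .of_surjective' _ hsurj
    obtain ⟨hdom, rs', hreg, hrs⟩ := ih
      ((s.erase y).image (Ideal.Quotient.mk (Ideal.span {x})))
      (by rw [Finset.coe_image, ← Ideal.map_span, ← span_singleton_sup_eq_maximalIdeal_iff, hsup])
      (Finset.card_image_le.trans (by rw [Finset.card_erase_of_mem hy]; omega))
      (by
        have h1 := ringKrullDim_le_ringKrullDim_quotient_add_card ({x} : Finset R)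
          (by simpa [ringJacobson_eq_maximalIdeal] using hx)
        rw [Finset.coe_singleton, Finset.card_singleton] at h1
        have h2 := hdim.trans h1
        push_cast at h2
        by_contra hlt
        have h3 := h2.trans (ENat.WithBot.add_one_le_natCast_iff.mpr (not_le.mp hlt))
        norm_cast at h3
        omega)
    have hRdom := isDomain_of_isDomain_quotient_span_singleton hx hxmin
    obtain ⟨rs, rfl⟩ := List.map_surjective_iff.mpr hsurj rs'
    refine ⟨hRdom, x :: rs, ?_, ?_⟩
    · rw [isWeaklyRegular_cons_iff]
      have hx0 : x ≠ 0 := by rintro rfl; exact hx2 (Ideal.zero_mem _)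
      refine ⟨fun a b hab ↦ mul_left_cancel₀ hx0 hab, ?_⟩
      have h1 := (isWeaklyRegular_map_algebraMap_iff (R := R)
        (R ⧸ Ideal.span {x}) (R ⧸ Ideal.span {x}) rs).mp hreg
      refine (LinearEquiv.isWeaklyRegular_congr (Submodule.quotEquivOfEq _ _ ?_) rs).mp h1
      rw [← Submodule.ideal_span_singleton_smul]
      simp
    · rw [Ideal.ofList_cons, span_singleton_sup_eq_maximalIdeal_iff, Ideal.map_ofList, hrs]

open IsLocalRing RingTheory.Sequence in
/-- The maximal ideal of a regular local ring is generated by a regular sequence. -/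
theorem IsRegularLocalRing.exists_isWeaklyRegular_ofList_eq (R : Type*) [CommRing R]
    [IsRegularLocalRing R] :
    ∃ rs : List R, IsWeaklyRegular R rs ∧ Ideal.ofList rs = maximalIdeal R := by
  obtain ⟨s, hcard, hs⟩ := Submodule.FG.exists_span_finset_card_eq_spanFinrank
    (IsNoetherian.noetherian (maximalIdeal R))
  exact (isDomain_and_exists_isWeaklyRegular_of_card_le _ s hs hcard.le
    (IsRegularLocalRing.spanFinrank_maximalIdeal (R := R)).le).2

/-! ### Freeness and powers of regular sequences. -/

open IsLocalRing RingTheory.Sequence in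
/-- A finite module over a Noetherian local ring is free if the maximal ideal is generated by a
sequence that is regular on the module. -/
theorem IsLocalRing.free_of_isWeaklyRegular_of_ofList_eq_maximalIdeal :
    ∀ {R : Type*} [CommRing R] [IsLocalRing R] [IsNoetherianRing R] (M : Type*) [AddCommGroup M]
      [Module R M] [Module.Finite R M] (rs : List R), IsWeaklyRegular M rs →
      Ideal.ofList rs = maximalIdeal R → Module.Free R M := by
  intro R _ _ _ M _ _ _ rs
  induction h : rs.length generalizing R M with
  | zero =>
    intro _ hrs
    obtain rfl := List.length_eq_zero_iff.mp h
    have hf : IsField R := isField_iff_maximalIdeal_eq.mpr (by rw [← hrs, Ideal.ofList_nil])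
    let := hf.toField
    exact Module.Free.of_divisionRing R M
  | succ n ih =>
    intro hreg hrs
    obtain ⟨x, rs, rfl⟩ := List.exists_cons_of_length_eq_add_one h
    have hx : x ∈ maximalIdeal R := hrs ▸ Ideal.subset_span (by simp)
    rw [isWeaklyRegular_cons_iff'] at hreg
    have hsurj := Ideal.Quotient.mk_surjective (I := Ideal.span {x})
    have : Nontrivial (R ⧸ Ideal.span {x}) :=
      Ideal.Quotient.nontrivial_iff.mpr (ne_top_of_le_ne_top (maximalIdeal.isMaximal R).ne_top
        ((Ideal.span_singleton_le_iff_mem _).mpr hx))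
    have : IsLocalRing (R ⧸ Ideal.span {x}) := .of_surjective' _ hsurj
    have : Module.FinitePresentation R M := Module.finitePresentation_of_finite R M
    have : Module.Finite (R ⧸ Ideal.span {x}) (QuotSMulTop x M) :=
      Module.Finite.of_restrictScalars_finite R _ _
    rw [← Module.free_quotSMulTop_iff_free R M (maximalIdeal_le_jacobson _ hx) hreg.1]
    refine ih _ (rs.map (Ideal.Quotient.mk (Ideal.span {x}))) (by simpa using h) hreg.2 ?_
    rw [← Ideal.map_ofList, ← span_singleton_sup_eq_maximalIdeal_iff, ← Ideal.ofList_cons, hrs]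

-- Regular sequences in m may be permuted, so the element to be raised to a power can be moved to
-- the end, where only a power of a nonzerodivisor modulo the others is involved.
open IsLocalRing RingTheory.Sequence in
theorem IsLocalRing.isWeaklyRegular_map_pow_append {R : Type*} [CommRing R] [IsLocalRing R]
    [IsNoetherianRing R] (n : ℕ) (l₁ l₂ : List R) (h : IsWeaklyRegular R (l₁ ++ l₂))
    (hm : ∀ x ∈ l₁ ++ l₂, x ∈ maximalIdeal R) :
    IsWeaklyRegular R (l₁.map (· ^ (n + 1)) ++ l₂) := by
  induction l₁ generalizing l₂ with
  | nil => simpa using h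
  | cons x l₁ ih =>
    have hpow : ∀ y ∈ l₁.map (· ^ (n + 1)), y ∈ maximalIdeal R := by
      intro y hy
      obtain ⟨z, hz, rfl⟩ := List.mem_map.mp hy
      exact Ideal.pow_mem_of_mem _ (hm z (by simp [hz])) _ n.succ_pos
    have hx := hm x (by simp)
    have h1 := ih (x :: l₂)
      (isWeaklyRegular_of_perm_of_subset_maximalIdeal h (by
        simpa using List.perm_middle.symm) hm)
      (fun y hy ↦ hm y (by simp at hy ⊢; tauto))
    have h2 := isWeaklyRegular_of_perm_of_subset_maximalIdeal h1
      (rs' := (l₁.map (· ^ (n + 1)) ++ l₂) ++ [x])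
      (by simpa using! (List.perm_append_singleton x l₂).symm.append_left _) (by
        intro y hy
        rcases List.mem_append.mp hy with hy | hy
        · exact hpow y hy
        · exact hm y (by simp at hy ⊢; tauto))
    rw [isWeaklyRegular_append_iff, isWeaklyRegular_singleton_iff] at h2
    have h3 : IsWeaklyRegular R ((l₁.map (· ^ (n + 1)) ++ l₂) ++ [x ^ (n + 1)]) := by
      rw [isWeaklyRegular_append_iff, isWeaklyRegular_singleton_iff]
      exact ⟨h2.1, h2.2.pow _⟩
    refine isWeaklyRegular_of_perm_of_subset_maximalIdeal h3
      (List.perm_append_singleton (x ^ (n + 1)) _) ?_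
    intro y hy
    rcases List.mem_append.mp hy with hy | hy
    · rcases List.mem_append.mp hy with hy | hy
      · exact hpow y hy
      · exact hm y (by simp [hy])
    · rw [List.mem_singleton.mp hy]
      exact Ideal.pow_mem_of_mem _ hx _ n.succ_pos

/-! ### Socle generators modulo powers of a regular sequence. -/

/-- The class of `u` is nonzero in `R ⧸ J` and is contained in every nonzero ideal of `R ⧸ J`. -/
structure Ideal.IsEssentialSocleGenerator {R : Type*} [CommRing R] (J : Ideal R) (u : R) :
    Prop where
  notMem : u ∉ J
  mem_of_notMem : ∀ a, a ∉ J → u ∈ Ideal.span {a} ⊔ J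

theorem Ideal.IsEssentialSocleGenerator.sup_span_pow {R : Type*} [CommRing R] {Q : Ideal R}
    {x u : R} (hu : (Q ⊔ Ideal.span {x}).IsEssentialSocleGenerator u)
    (hx : ∀ a, x * a ∈ Q → a ∈ Q) (n : ℕ) :
    (Q ⊔ Ideal.span {x ^ (n + 1)}).IsEssentialSocleGenerator (x ^ n * u) := by
  have hxn : ∀ (k : ℕ) a, x ^ k * a ∈ Q → a ∈ Q := by
    intro k
    induction k with
    | zero => simp
    | succ k ih => exact fun a ha ↦ hx a (ih _ (by rwa [← mul_assoc, ← pow_succ]))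
  refine ⟨fun hmem ↦ hu.notMem ?_, fun a ha ↦ ?_⟩
  · obtain ⟨r, hr, t, ht, hrt⟩ := Submodule.mem_sup.mp hmem
    obtain ⟨c, rfl⟩ := Ideal.mem_span_singleton'.mp ht
    have h1 : u - c * x ∈ Q := hxn n _ (by
      have : x ^ n * (u - c * x) = r := by rw [mul_sub, ← hrt]; ring
      rwa [this])
    rw [← sub_add_cancel u (c * x)]
    exact Ideal.add_mem _ (Ideal.mem_sup_left h1)
      (Ideal.mem_sup_right (Ideal.mem_span_singleton'.mpr ⟨c, rfl⟩))
  · classical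
    -- With k + 1 the least such exponent, a ≡ b x^k modulo Q with b ∉ Q + (x). Then u is a multiple
    -- of b modulo Q + (x), and multiplying by x^n makes x^n u a multiple of a modulo Q + (x^(n+1)).
    have hex : ∃ k, a ∉ Q ⊔ Ideal.span {x ^ k} := ⟨n + 1, ha⟩
    obtain ⟨k, hk⟩ : ∃ k, Nat.find hex = k + 1 := Nat.exists_eq_succ_of_ne_zero fun h0 ↦ by
      have := Nat.find_spec hex
      simp [h0] at this
    have hkn : k ≤ n := by
      have := Nat.find_min' hex ha
      omega
    have h1 : a ∈ Q ⊔ Ideal.span {x ^ k} := not_not.mp (Nat.find_min hex (by omega))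
    have h2 : a ∉ Q ⊔ Ideal.span {x ^ (k + 1)} := hk ▸ Nat.find_spec hex
    obtain ⟨g, hg, t, ht, rfl⟩ := Submodule.mem_sup.mp h1
    obtain ⟨b, rfl⟩ := Ideal.mem_span_singleton'.mp ht
    have hb : b ∉ Q ⊔ Ideal.span {x} := fun hb ↦ h2 (by
      obtain ⟨g', hg', t', ht', rfl⟩ := Submodule.mem_sup.mp hb
      obtain ⟨c, rfl⟩ := Ideal.mem_span_singleton'.mp ht'
      have : g + (g' + c * x) * x ^ k = (g + x ^ k * g') + c * x ^ (k + 1) := by ring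
      rw [this]
      exact Ideal.add_mem _ (Ideal.mem_sup_left (Ideal.add_mem _ hg (Ideal.mul_mem_left _ _ hg')))
        (Ideal.mem_sup_right (Ideal.mem_span_singleton'.mpr ⟨c, rfl⟩)))
    obtain ⟨t, ht, r, hr, hu'⟩ := Submodule.mem_sup.mp (hu.mem_of_notMem b hb)
    obtain ⟨c, rfl⟩ := Ideal.mem_span_singleton'.mp ht
    obtain ⟨g', hg', t', ht', rfl⟩ := Submodule.mem_sup.mp hr
    obtain ⟨d, rfl⟩ := Ideal.mem_span_singleton'.mp ht'
    obtain ⟨j, rfl⟩ := Nat.exists_eq_add_of_le hkn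
    have : x ^ (k + j) * u = (x ^ j * c) * (g + b * x ^ k) +
        ((x ^ (k + j) * g' - x ^ j * c * g) + d * x ^ (k + j + 1)) := by
      rw [← hu']; ring
    rw [this]
    refine Ideal.add_mem _ (Ideal.mem_sup_left (Ideal.mem_span_singleton'.mpr ⟨_, rfl⟩))
      (Ideal.mem_sup_right (Ideal.add_mem _ (Ideal.mem_sup_left (Ideal.sub_mem _
        (Ideal.mul_mem_left _ _ hg') (Ideal.mul_mem_left _ _ hg)))
        (Ideal.mem_sup_right (Ideal.mem_span_singleton'.mpr ⟨d, rfl⟩))))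

-- Start from the socle generator 1 of R/m and raise the generators to the power n + 1 one at a
-- time; each contributes a factor x^n by `sup_span_pow`.
open IsLocalRing RingTheory.Sequence in
theorem IsLocalRing.isEssentialSocleGenerator_ofList_map_pow_append {R : Type*} [CommRing R]
    [IsLocalRing R] [IsNoetherianRing R] (n : ℕ) (l₁ l₂ : List R)
    (h : IsWeaklyRegular R (l₁ ++ l₂)) (hm : Ideal.ofList (l₁ ++ l₂) = maximalIdeal R) :
    (Ideal.ofList (l₁.map (· ^ (n + 1)) ++ l₂)).IsEssentialSocleGenerator
      (l₁.map (· ^ n)).prod := by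
  have hmem : ∀ x ∈ l₁ ++ l₂, x ∈ maximalIdeal R := fun x hx ↦ hm ▸ Ideal.subset_span hx
  induction l₁ generalizing l₂ with
  | nil =>
    simp only [List.nil_append] at hm
    simp only [List.map_nil, List.nil_append, List.prod_nil, hm]
    refine ⟨(Ideal.ne_top_iff_one _).mp (maximalIdeal.isMaximal R).ne_top, fun a ha ↦ ?_⟩
    rw [Ideal.span_singleton_eq_top.mpr (notMem_maximalIdeal.mp ha)]
    simp
  | cons x l₁ ih =>
    have hperm : ((x :: l₁) ++ l₂).Perm (l₁ ++ x :: l₂) := by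
      simpa using List.perm_middle.symm
    have hreg := isWeaklyRegular_of_perm_of_subset_maximalIdeal h hperm hmem
    have hmem' : ∀ y ∈ l₁ ++ x :: l₂, y ∈ maximalIdeal R :=
      fun y hy ↦ hmem y (hperm.mem_iff.mpr hy)
    have h1 := ih (x :: l₂) hreg
      (by rw [← hm]; simp only [Ideal.ofList_append, Ideal.ofList_cons]; ac_rfl) hmem'
    have h2 := isWeaklyRegular_of_perm_of_subset_maximalIdeal
      (isWeaklyRegular_map_pow_append n l₁ (x :: l₂) hreg hmem')
      (rs' := (l₁.map (· ^ (n + 1)) ++ l₂) ++ [x])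
      (by simpa using! (List.perm_append_singleton x l₂).symm.append_left _) (by
        intro y hy
        rcases List.mem_append.mp hy with hy | hy
        · obtain ⟨z, hz, rfl⟩ := List.mem_map.mp hy
          exact Ideal.pow_mem_of_mem _ (hmem z (by simp [hz])) _ n.succ_pos
        · exact hmem' y (by simp at hy ⊢; tauto))
    rw [isWeaklyRegular_append_iff, isWeaklyRegular_singleton_iff,
      isSMulRegular_quotient_iff_mem_of_smul_mem] at h2
    have h3 := Ideal.IsEssentialSocleGenerator.sup_span_pow
      (Q := Ideal.ofList (l₁.map (· ^ (n + 1)) ++ l₂)) (x := x) (u := (l₁.map (· ^ n)).prod)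
      (by
        convert! h1 using 1
        simp only [Ideal.ofList_append, Ideal.ofList_cons]; ac_rfl)
      (by simpa using h2.2) n
    convert! h3 using 1
    simp only [List.map_cons, List.cons_append, Ideal.ofList_append, Ideal.ofList_cons]; ac_rfl

/-! ### Frobenius pushforwards and Frobenius powers. -/

namespace FrobPush

variable {p e : ℕ} {R : Type*} [CommRing R] [Fact p.Prime] [CharP R p]

theorem finite_iff : Module.Finite R (FrobPush p e R) ↔ (iterateFrobenius R p e).Finite := Iff.rfl

theorem flat_iff : Module.Flat R (FrobPush p e R) ↔ (iterateFrobenius R p e).Flat := Iff.rfl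

end FrobPush

theorem IsFFinite.finite_frobPush {p : ℕ} {R : Type*} [CommRing R] [Fact p.Prime] [CharP R p]
    (h : IsFFinite p R) (e : ℕ) : Module.Finite R (FrobPush p e R) := by
  rw [FrobPush.finite_iff]
  induction e with
  | zero => simpa using RingHom.Finite.id R
  | succ e ih =>
    rw [iterateFrobenius_add]
    exact ih.comp (FrobPush.finite_iff.mp h)

theorem frobPower_eq_map {p e : ℕ} {R : Type*} [CommRing R] [Fact p.Prime] [CharP R p]
    (I : Ideal R) : frobPower p e I = I.map (iterateFrobenius R p e) := rfl

theorem pow_mem_frobPower {p e : ℕ} {R : Type*} [CommRing R] {I : Ideal R} {x : R} (hx : x ∈ I) :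
    x ^ p ^ e ∈ frobPower p e I :=
  Ideal.subset_span ⟨x, hx, rfl⟩

theorem frobPower_zero {p : ℕ} {R : Type*} [CommRing R] (I : Ideal R) : frobPower p 0 I = I := by
  simp [frobPower]

theorem le_radical_frobPower {p e : ℕ} {R : Type*} [CommRing R] (I : Ideal R) :
    I ≤ (frobPower p e I).radical :=
  fun _ hx ↦ ⟨p ^ e, pow_mem_frobPower hx⟩

theorem map_frobPower {p e : ℕ} {R T : Type*} [CommRing R] [CommRing T] [Fact p.Prime] [CharP R p]
    [CharP T p] (f : R →+* T) (I : Ideal R) :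
    (frobPower p e I).map f = frobPower p e (I.map f) := by
  rw [frobPower_eq_map, frobPower_eq_map, Ideal.map_map, Ideal.map_map]
  congr 1
  ext x
  simp [iterateFrobenius_def]

theorem CharP.of_ringHom_of_prime {p : ℕ} (hp : p.Prime) {R T : Type*} [CommRing R] [CommRing T]
    [CharP R p] [Nontrivial T] (f : R →+* T) : CharP T p := by
  rw [CharP.charP_iff_prime_eq_zero hp, ← map_natCast f, CharP.cast_eq_zero, map_zero]

/-! ### Kunz's theorem and the socle of R/m^[p^e], local case. -/

section Regular

open IsLocalRing RingTheory.Sequence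

/-- Kunz's theorem, in the `F`-finite case: Frobenius is flat on a regular local ring. -/
theorem IsRegularLocalRing.flat_frobPush {p e : ℕ} {R : Type*} [CommRing R] [Fact p.Prime]
    [CharP R p] [IsRegularLocalRing R] [Module.Finite R (FrobPush p e R)] :
    Module.Flat R (FrobPush p e R) := by
  obtain ⟨rs, hreg, hrs⟩ := IsRegularLocalRing.exists_isWeaklyRegular_ofList_eq R
  have hpow := isWeaklyRegular_map_pow_append (p ^ e - 1) rs []
    (by simpa using hreg) (fun x hx ↦ hrs ▸ Ideal.subset_span (by simpa using hx))
  rw [List.append_nil, Nat.sub_add_cancel (Nat.pos_of_ne_zero (pow_ne_zero e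
    (Fact.out : p.Prime).ne_zero))] at hpow
  -- An element r acts on F^e_*R as multiplication by r^(p^e) on R, so this is regularity of the
  -- powers on R.
  have : IsWeaklyRegular (FrobPush p e R) rs := by
    refine (AddEquiv.isWeaklyRegular_congr (e := (FrobPush.of p e (R := R)).toAddEquiv) ?_).mp hpow
    rw [List.forall₂_map_left_iff, List.forall₂_same]
    exact fun r _ x ↦ rfl
  have := free_of_isWeaklyRegular_of_ofList_eq_maximalIdeal _ rs this hrs
  infer_instance

theorem IsRegularLocalRing.exists_isEssentialSocleGenerator_frobPower {p e : ℕ} {R : Type*}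
    [CommRing R] [Fact p.Prime] [CharP R p] [IsRegularLocalRing R] :
    ∃ u, (frobPower p e (maximalIdeal R)).IsEssentialSocleGenerator u := by
  obtain ⟨rs, hreg, hrs⟩ := IsRegularLocalRing.exists_isWeaklyRegular_ofList_eq R
  have h := isEssentialSocleGenerator_ofList_map_pow_append (p ^ e - 1) rs []
    (by simpa using hreg) (by simpa using hrs)
  rw [List.append_nil, Nat.sub_add_cancel (Nat.pos_of_ne_zero (pow_ne_zero e
    (Fact.out : p.Prime).ne_zero))] at h
  rw [← hrs, frobPower_eq_map, Ideal.map_ofList]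
  exact ⟨_, h⟩

end Regular

/-! ### Passage from local rings to the global ring. -/

/-- Images of generators still generate, since F^e_*(a/t) = (1/t) • F^e_*(t^(p^e - 1) a). -/
theorem FrobPush.finite_localization {p e : ℕ} {R : Type*} [CommRing R] [Fact p.Prime] [CharP R p]
    [Module.Finite R (FrobPush p e R)] (M : Submonoid R) (T : Type*) [CommRing T] [Algebra R T]
    [CharP T p] [IsLocalization M T] : Module.Finite T (FrobPush p e T) := by
  obtain ⟨G, hG⟩ := Module.Finite.fg_top (R := R) (M := FrobPush p e R)
  let g : FrobPush p e R →ₛₗ[algebraMap R T] FrobPush p e T :=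
    { toFun x := of p e (algebraMap R T ((of p e).symm x))
      map_add' x y := by simp
      map_smul' r x := by
        obtain ⟨x, rfl⟩ := (of p e).surjective x
        simp [smul_of] }
  classical
  refine ⟨⟨G.image g, ?_⟩⟩
  rw [Finset.coe_image, eq_top_iff]
  have hg : ∀ x, g x ∈ Submodule.span T (g '' (G : Set (FrobPush p e R))) := by
    intro x
    have hx : x ∈ Submodule.span R (G : Set (FrobPush p e R)) := hG ▸ Submodule.mem_top
    induction hx using Submodule.span_induction with
    | mem x hx => exact Submodule.subset_span ⟨x, hx, rfl⟩
    | zero => simp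
    | add x y _ _ hx hy => rw [map_add]; exact Submodule.add_mem _ hx hy
    | smul r x _ hx => rw [map_smulₛₗ]; exact Submodule.smul_mem _ _ hx
  intro y _
  obtain ⟨y, rfl⟩ := (of p e).surjective y
  obtain ⟨⟨a, t⟩, rfl⟩ := IsLocalization.mk'_surjective M y
  have hpos : 0 < p ^ e := Nat.pos_of_ne_zero (pow_ne_zero e (Fact.out : p.Prime).ne_zero)
  have : of p e (IsLocalization.mk' T a t) =
      IsLocalization.mk' T 1 t • g (of p e ((t : R) ^ (p ^ e - 1) * a)) := by
    change _ = _ • of p e (algebraMap R T ((t : R) ^ (p ^ e - 1) * a))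
    rw [smul_of]
    congr 1
    rw [IsLocalization.mk'_eq_iff_eq_mul, map_mul, map_pow]
    have h1 : IsLocalization.mk' T 1 t * algebraMap R T t = 1 := by simp
    calc algebraMap R T a
        = (IsLocalization.mk' T 1 t * algebraMap R T t) ^ p ^ e * algebraMap R T a := by
          rw [h1]; simp
      _ = _ := by
          rw [mul_pow]
          obtain ⟨n, hn⟩ := Nat.exists_eq_add_of_lt hpos
          rw [hn]
          simp
          ring
  change of p e (IsLocalization.mk' T a t) ∈ _
  rw [this]
  exact Submodule.smul_mem _ _ (hg _)

theorem IsRegularRing.projective_frobPush {p : ℕ} {S : Type*} [CommRing S] [Fact p.Prime]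
    [CharP S p] [IsRegularRing S] (e : ℕ) [Module.Finite S (FrobPush p e S)] :
    Module.Projective S (FrobPush p e S) := by
  have : Module.Flat S (FrobPush p e S) := by
    rw [FrobPush.flat_iff]
    refine RingHom.Flat.ofLocalizationPrime _ fun P hP ↦ ?_
    -- Frobenius contracts P to itself, but only propositionally; with Q a variable the equality can
    -- be substituted, and the localized map becomes the Frobenius of the localization.
    have key : ∀ (Q : Ideal S) [Q.IsPrime] (hQ : Q = P.comap (iterateFrobenius S p e)), Q = P →
        (Localization.localRingHom Q P _ hQ).Flat := by
      rintro Q _ hQ rfl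
      have := CharP.of_ringHom_of_prime (p := p) Fact.out
        (algebraMap S (Localization.AtPrime Q))
      have := FrobPush.finite_localization (p := p) (e := e) Q.primeCompl (Localization.AtPrime Q)
      rw [Localization.localRingHom_unique Q Q _ hQ
        (j := iterateFrobenius (Localization.AtPrime Q) p e)
        (fun x ↦ by simp [iterateFrobenius_def]), ← FrobPush.flat_iff]
      exact IsRegularLocalRing.flat_frobPush
    refine key _ rfl ?_
    ext x
    rw [Ideal.mem_comap, iterateFrobenius_def]
    exact ⟨hP.mem_of_pow_mem _, fun h ↦ Ideal.pow_mem_of_mem _ h _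
      (Nat.pos_of_ne_zero (pow_ne_zero e (Fact.out : p.Prime).ne_zero))⟩
  have := Module.finitePresentation_of_finite S (FrobPush p e S)
  exact Module.Flat.projective_of_finitePresentation

/-- No maximal ideal other than m can contain N, so t is a unit modulo N. -/
theorem Ideal.mem_of_mul_mem_of_le_radical {R : Type*} [CommRing R] {m N : Ideal R} [m.IsMaximal]
    (h : m ≤ N.radical) {t r : R} (ht : t ∉ m) (hr : t * r ∈ N) : r ∈ N := by
  have htop : Ideal.span {t} ⊔ N = ⊤ := by
    by_contra hne
    obtain ⟨M, hM, hle⟩ := Ideal.exists_le_maximal _ hne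
    have : m ≤ M := h.trans (hM.isPrime.radical_le_iff.mpr (le_sup_right.trans hle))
    rw [Ideal.IsMaximal.eq_of_le ‹_› hM.ne_top this] at ht
    exact ht (hle (Ideal.mem_sup_left (Ideal.mem_span_singleton_self t)))
  obtain ⟨x, hx, n, hn, h1⟩ := Submodule.mem_sup.mp ((Ideal.eq_top_iff_one _).mp htop)
  obtain ⟨c, rfl⟩ := Ideal.mem_span_singleton'.mp hx
  rw [← one_mul r, ← h1, add_mul, mul_assoc]
  exact Ideal.add_mem _ (Ideal.mul_mem_left _ _ hr) (Ideal.mul_mem_right _ _ hn)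

/-- Ideals containing N are contracted from the localization at m, so the numerator of a local socle
generator serves globally. -/
theorem Ideal.exists_isEssentialSocleGenerator_of_map_localization {R : Type*} [CommRing R]
    {m N : Ideal R} [m.IsMaximal] (h : m ≤ N.radical)
    (hN : ∃ u, (N.map (algebraMap R (Localization.AtPrime m))).IsEssentialSocleGenerator u) :
    ∃ u, N.IsEssentialSocleGenerator u := by
  have hmem : ∀ (K : Ideal R), N ≤ K → ∀ a, algebraMap R (Localization.AtPrime m) a ∈
      K.map (algebraMap R (Localization.AtPrime m)) → a ∈ K := by
    intro K hK a ha
    obtain ⟨t, ht, hta⟩ :=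
      (IsLocalization.algebraMap_mem_map_algebraMap_iff m.primeCompl _ K a).mp ha
    exact mem_of_mul_mem_of_le_radical (h.trans (Ideal.radical_mono hK)) ht hta
  obtain ⟨u, hu⟩ := hN
  obtain ⟨⟨s, t⟩, rfl⟩ := IsLocalization.mk'_surjective m.primeCompl u
  refine ⟨s, fun hs ↦ hu.notMem ?_, fun a ha ↦ hmem _ le_sup_right _ ?_⟩
  · change IsLocalization.mk' _ s t ∈ _
    rw [IsLocalization.mk'_mem_map_algebraMap_iff]
    exact ⟨1, one_mem _, by simpa using hs⟩
  · have h1 := hu.mem_of_notMem (algebraMap R _ a) fun h ↦ ha (hmem N le_rfl a h)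
    rw [← IsLocalization.mk'_spec (Localization.AtPrime m) s t, Ideal.map_sup, Ideal.map_span,
      Set.image_singleton]
    exact Ideal.mul_mem_right _ _ h1

theorem IsRegularRing.exists_isEssentialSocleGenerator_frobPower {p e : ℕ} {S : Type*} [CommRing S]
    [Fact p.Prime] [CharP S p] [IsRegularRing S] (m : Ideal S) [m.IsMaximal] :
    ∃ u, (frobPower p e m).IsEssentialSocleGenerator u := by
  refine Ideal.exists_isEssentialSocleGenerator_of_map_localization (le_radical_frobPower m) ?_
  have := CharP.of_ringHom_of_prime (p := p) Fact.out (algebraMap S (Localization.AtPrime m))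
  rw [map_frobPower, Localization.AtPrime.map_eq_maximalIdeal]
  exact IsRegularLocalRing.exists_isEssentialSocleGenerator_frobPower

theorem Module.exists_dual_family_of_projective (R M : Type*) [CommRing R] [AddCommGroup M]
    [Module R M] [Module.Finite R M] [Module.Projective R M] :
    ∃ (n : ℕ) (ψ : Fin n → M →ₗ[R] R) (b : Fin n → M), ∀ x, ∑ i, ψ i x • b i = x := by
  obtain ⟨n, f, g, -, -, h⟩ := Module.Finite.exists_comp_eq_id_of_projective R M
  refine ⟨n, fun i ↦ LinearMap.proj i ∘ₗ g, fun i ↦ f (Pi.single i 1), fun x ↦ ?_⟩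
  conv_rhs => rw [← LinearMap.id_apply (R := R) x, ← h, LinearMap.comp_apply,
    pi_eq_sum_univ' (g x), map_sum]
  simp [Pi.single]

/-! ### Functionals on F^e_*S. -/

namespace FrobPush

variable {p e : ℕ} {S : Type*} [CommRing S] [Fact p.Prime] [CharP S p]

theorem apply_mem_of_mem_frobPower (ψ : FrobPush p e S →ₗ[S] S) {L : Ideal S} {x : S}
    (hx : x ∈ frobPower p e L) : ψ (of p e x) ∈ L := by
  -- The factor c absorbs arbitrary ring coefficients in the span, with which ψ does not commute.
  suffices ∀ c, ψ (of p e (c * x)) ∈ L by simpa using this 1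
  induction hx using Submodule.span_induction with
  | mem x hx =>
    obtain ⟨y, hy, rfl⟩ := hx
    intro c
    have : ψ (of p e (c * y ^ p ^ e)) = y * ψ (of p e c) := by
      rw [mul_comm c, ← smul_of, map_smul, smul_eq_mul]
    exact this ▸ Ideal.mul_mem_right _ _ hy
  | zero => simp
  | add x y _ _ hx hy =>
    intro c
    rw [mul_add, map_add, map_add]
    exact Ideal.add_mem _ (hx c) (hy c)
  | smul r x _ hx =>
    intro c
    rw [smul_eq_mul, ← mul_assoc]
    exact hx _

/-- The dual-basis coordinates of F^e_*x lie in L, and they act on F^e_*S through their p^e-th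
powers. -/
theorem mem_frobPower_of_forall_apply_mem [Module.Finite S (FrobPush p e S)]
    [Module.Projective S (FrobPush p e S)] {L : Ideal S} {x : S}
    (h : ∀ ψ : FrobPush p e S →ₗ[S] S, ψ (of p e x) ∈ L) : x ∈ frobPower p e L := by
  obtain ⟨n, ψ, b, hb⟩ := Module.exists_dual_family_of_projective S (FrobPush p e S)
  have hx : x = ∑ i, ψ i (of p e x) ^ p ^ e * (of p e).symm (b i) := by
    apply (of p e).injective
    conv_lhs => rw [← hb (of p e x)]
    rw [map_sum]
    rfl
  rw [hx]
  exact Ideal.sum_mem _ fun i _ ↦ Ideal.mul_mem_right _ _ (pow_mem_frobPower (h _))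

/-- The map `b ↦ (x ↦ Φ (b * x))`. -/
noncomputable def mulForm (Φ : FrobPush p e S →ₗ[S] S) : FrobPush p e S →ₗ[S] FrobPush p e S →ₗ[S] S :=
  LinearMap.mk₂ S (fun b x ↦ Φ (b * x)) (fun _ _ _ ↦ by rw [add_mul, map_add])
    (fun s b x ↦ by
      rw [← map_smul]
      exact congrArg Φ (mul_assoc (of p e (s ^ p ^ e)) b x))
    (fun _ _ _ ↦ by rw [mul_add, map_add])
    (fun s b x ↦ by
      rw [← map_smul]
      exact congrArg Φ (mul_left_comm b (of p e (s ^ p ^ e)) x))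

@[simp]
theorem mulForm_apply (Φ : FrobPush p e S →ₗ[S] S) (b x : FrobPush p e S) :
    mulForm Φ b x = Φ (b * x) := rfl

/-- Modulo a maximal ideal `m`, the functionals on `F^e_* S` are multiples of a functional that does
not vanish on a socle generator of `S ⧸ m^[p^e]`. -/
theorem exists_apply_sub_mulForm_mem [Module.Finite S (FrobPush p e S)] {m : Ideal S}
    [hm : m.IsMaximal] {u : S} (hu : (frobPower p e m).IsEssentialSocleGenerator u)
    {Φ : FrobPush p e S →ₗ[S] S} (hΦ : Φ (of p e u) ∉ m) (ψ : FrobPush p e S →ₗ[S] S) :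
    ∃ b, ∀ x, (ψ - mulForm Φ b) x ∈ m := by
  let := Ideal.Quotient.field m
  set N := frobPower p e m
  -- Frobenius makes S/N a finite-dimensional vector space over the field S/m, and functionals on
  -- F^e_*S reduce to its dual.
  let f : S ⧸ m →+* S ⧸ N := Ideal.Quotient.lift m ((Ideal.Quotient.mk N).comp
    (iterateFrobenius S p e)) fun a ha ↦ Ideal.Quotient.eq_zero_iff_mem.mpr (pow_mem_frobPower ha)
  let := f.toAlgebra
  have hsmul (s x : S) : (Ideal.Quotient.mk m s) • (Ideal.Quotient.mk N x) =
      Ideal.Quotient.mk N (s ^ p ^ e * x) := by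
    rw [Algebra.smul_def, map_mul]; rfl
  have hfin : Module.Finite (S ⧸ m) (S ⧸ N) :=
    let π : FrobPush p e S →ₛₗ[Ideal.Quotient.mk m] S ⧸ N :=
      { toFun x := Ideal.Quotient.mk N ((of p e).symm x)
        map_add' x y := by simp
        map_smul' s x := by
          obtain ⟨x, rfl⟩ := (of p e).surjective x
          rw [smul_of, RingEquiv.symm_apply_apply, RingEquiv.symm_apply_apply, hsmul] }
    Module.Finite.of_surjective π
      (Ideal.Quotient.mk_surjective.comp (of p e (R := S)).symm.surjective)
  have hlift (χ : FrobPush p e S →ₗ[S] S) : ∃ χ' : S ⧸ N →ₗ[S ⧸ m] S ⧸ m,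
      ∀ x, χ' (Ideal.Quotient.mk N x) = Ideal.Quotient.mk m (χ (of p e x)) := by
    let χ₀ : S ⧸ N →+ S ⧸ m := QuotientAddGroup.lift N.toAddSubgroup
      (((Ideal.Quotient.mk m).toAddMonoidHom.comp χ.toAddMonoidHom).comp
        (of p e (R := S)).toAddMonoidHom)
      fun x hx ↦ Ideal.Quotient.eq_zero_iff_mem.mpr (apply_mem_of_mem_frobPower χ hx)
    have hχ₀ (x : S) : χ₀ (Ideal.Quotient.mk N x) = Ideal.Quotient.mk m (χ (of p e x)) := rfl
    refine ⟨{ χ₀ with map_smul' := fun s x ↦ ?_ }, hχ₀⟩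
    obtain ⟨s, rfl⟩ := Ideal.Quotient.mk_surjective s
    obtain ⟨x, rfl⟩ := Ideal.Quotient.mk_surjective x
    change χ₀ _ = _ • χ₀ _
    rw [hsmul, hχ₀, hχ₀, ← smul_of, map_smul, smul_eq_mul, map_mul, smul_eq_mul, RingHom.id_apply]
  obtain ⟨Φ', hΦ'⟩ := hlift Φ
  obtain ⟨ψ', hψ'⟩ := hlift ψ
  let T : S ⧸ N →ₗ[S ⧸ m] Module.Dual (S ⧸ m) (S ⧸ N) := (LinearMap.mul (S ⧸ m) (S ⧸ N)).compr₂ Φ'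
  have hT (a x) : T a x = Φ' (a * x) := rfl
  -- A nonzero a in the kernel would have u among its multiples modulo N, forcing Φ(u) ∈ m. Equality
  -- of dimensions then gives surjectivity onto the dual.
  have hinj : Function.Injective T := by
    rw [← LinearMap.ker_eq_bot, LinearMap.ker_eq_bot']
    intro a ha
    obtain ⟨a, rfl⟩ := Ideal.Quotient.mk_surjective a
    rw [Ideal.Quotient.eq_zero_iff_mem]
    by_contra haN
    obtain ⟨y, hy, n, hn, hyn⟩ := Submodule.mem_sup.mp (hu.mem_of_notMem a haN)
    obtain ⟨c, rfl⟩ := Ideal.mem_span_singleton'.mp hy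
    refine hΦ (Ideal.Quotient.eq_zero_iff_mem.mp ?_)
    rw [← hΦ', ← hyn, map_add, Ideal.Quotient.eq_zero_iff_mem.mpr hn, add_zero, mul_comm, map_mul,
      ← hT, ha, LinearMap.zero_apply]
  have hsurj := (LinearMap.injective_iff_surjective_of_finrank_eq_finrank
    (Subspace.dual_finrank_eq (K := S ⧸ m) (V := S ⧸ N)).symm).mp hinj
  obtain ⟨b, hb⟩ := hsurj ψ'
  obtain ⟨b, rfl⟩ := Ideal.Quotient.mk_surjective b
  refine ⟨of p e b, fun x ↦ ?_⟩
  obtain ⟨x, rfl⟩ := (of p e).surjective x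
  rw [← Ideal.Quotient.eq_zero_iff_mem, LinearMap.sub_apply, mulForm_apply, map_sub, ← map_mul,
    ← hψ', ← hΦ', ← hb, hT, (Ideal.Quotient.mk N).map_mul, sub_self]

/-- Expanding ψ in a dual basis turns the pointwise condition into the form Nakayama requires. -/
theorem mem_smul_top_of_forall_apply_mem [Module.Finite S (FrobPush p e S)]
    [Module.Projective S (FrobPush p e S)] {m : Ideal S} {ψ : FrobPush p e S →ₗ[S] S}
    (h : ∀ x, ψ x ∈ m) : ψ ∈ m • (⊤ : Submodule S (FrobPush p e S →ₗ[S] S)) := by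
  obtain ⟨n, χ, b, hb⟩ := Module.exists_dual_family_of_projective S (FrobPush p e S)
  have : ψ = ∑ i, ψ (b i) • χ i := by
    ext x
    conv_lhs => rw [← hb x, map_sum]
    simp [mul_comm]
  rw [this]
  exact Submodule.sum_mem _ fun i _ ↦ Submodule.smul_mem_smul (h _) trivial

/-- Near each maximal ideal of a regular `F`-finite ring, the module of functionals on `F^e_* S` is
cyclic over `F^e_* S`. -/
theorem exists_smul_eq_mulForm [IsRegularRing S] [Module.Finite S (FrobPush p e S)]
    [Module.Projective S (FrobPush p e S)] (m : Ideal S) [hm : m.IsMaximal] :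
    ∃ r ∉ m, ∃ Φ : FrobPush p e S →ₗ[S] S, ∀ ψ : FrobPush p e S →ₗ[S] S,
      ∃ b : S, ∀ x : S, r * ψ (of p e x) = Φ (of p e (b * x)) := by
  obtain ⟨u, hu⟩ := IsRegularRing.exists_isEssentialSocleGenerator_frobPower (p := p) (e := e) m
  obtain ⟨Φ, hΦ⟩ : ∃ Φ : FrobPush p e S →ₗ[S] S, Φ (of p e u) ∉ m := by
    by_contra! h
    exact hu.notMem (mem_frobPower_of_forall_apply_mem h)
  let W := LinearMap.range (mulForm Φ)
  -- Nakayama for Hom(F^e_*S, S) modulo the multiples of Φ: some r ≡ 1 mod m kills this quotient,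
  -- with no need to localize.
  obtain ⟨r, hr, hr0⟩ := Submodule.exists_sub_one_mem_and_smul_eq_zero_of_fg_of_le_smul m
    (⊤ : Submodule S ((FrobPush p e S →ₗ[S] S) ⧸ W)) Module.Finite.fg_top (by
      rintro ψ -
      obtain ⟨ψ, rfl⟩ := W.mkQ_surjective ψ
      obtain ⟨b, hb⟩ := exists_apply_sub_mulForm_mem hu hΦ ψ
      have h1 := Submodule.mem_map_of_mem (f := W.mkQ) (mem_smul_top_of_forall_apply_mem hb)
      rw [Submodule.map_smul'', map_sub, W.mkQ_apply (mulForm Φ b),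
        (Submodule.Quotient.mk_eq_zero W).mpr ⟨b, rfl⟩] at h1
      simpa using h1)
  refine ⟨r, fun hrm ↦ hm.ne_top ((Ideal.eq_top_iff_one _).mpr ?_), Φ, fun ψ ↦ ?_⟩
  · simpa using Ideal.sub_mem _ hrm hr
  · obtain ⟨b, hb⟩ := (Submodule.Quotient.mk_eq_zero W).mp (hr0 (W.mkQ ψ) trivial)
    refine ⟨(of p e).symm b, fun x ↦ ?_⟩
    exact (LinearMap.congr_fun hb (of p e x)).symm

theorem exists_lift_quotient {I : Ideal S} [CharP (S ⧸ I) p]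
    [Module.Projective S (FrobPush p e S)] (φ : FrobPush p e (S ⧸ I) →ₗ[S ⧸ I] S ⧸ I) :
    ∃ ψ : FrobPush p e S →ₗ[S] S, ∀ x,
      Ideal.Quotient.mk I (ψ (of p e x)) = φ (of p e (Ideal.Quotient.mk I x)) := by
  let φ' : FrobPush p e S →ₗ[S] S ⧸ I :=
    { toFun x := φ (of p e (Ideal.Quotient.mk I ((of p e).symm x)))
      map_add' x y := by simp
      map_smul' s x := by
        obtain ⟨x, rfl⟩ := (of p e).surjective x
        rw [smul_of, RingEquiv.symm_apply_apply, RingEquiv.symm_apply_apply, map_mul, map_pow,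
          ← smul_of, map_smul]
        rfl }
  obtain ⟨ψ, hψ⟩ := Module.projective_lifting_property I.mkQ φ' I.mkQ_surjective
  exact ⟨ψ, fun x ↦ LinearMap.congr_fun hψ (of p e x)⟩

theorem exists_desc_quotient {I : Ideal S} [CharP (S ⧸ I) p] (ψ : FrobPush p e S →ₗ[S] S)
    (hψ : ∀ x ∈ I, ψ (of p e x) ∈ I) :
    ∃ φ : FrobPush p e (S ⧸ I) →ₗ[S ⧸ I] S ⧸ I, ∀ x,
      φ (of p e (Ideal.Quotient.mk I x)) = Ideal.Quotient.mk I (ψ (of p e x)) := by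
  let φ₀ : S ⧸ I →+ S ⧸ I := QuotientAddGroup.lift I.toAddSubgroup
    (((Ideal.Quotient.mk I).toAddMonoidHom.comp ψ.toAddMonoidHom).comp
      (of p e (R := S)).toAddMonoidHom)
    fun x hx ↦ Ideal.Quotient.eq_zero_iff_mem.mpr (hψ x hx)
  have hφ₀ (x : S) : φ₀ (Ideal.Quotient.mk I x) = Ideal.Quotient.mk I (ψ (of p e x)) := rfl
  refine ⟨{ toFun x := φ₀ ((of p e).symm x)
            map_add' x y := by simp
            map_smul' s x := ?_ }, hφ₀⟩
  obtain ⟨x, rfl⟩ := (of p e).surjective x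
  obtain ⟨s, rfl⟩ := Ideal.Quotient.mk_surjective s
  obtain ⟨x, rfl⟩ := Ideal.Quotient.mk_surjective x
  rw [smul_of, RingEquiv.symm_apply_apply, RingEquiv.symm_apply_apply, ← map_pow, ← map_mul, hφ₀,
    hφ₀, ← smul_of, map_smul, smul_eq_mul, map_mul, RingHom.id_apply, smul_eq_mul]

end FrobPush

/-! ### Fedder's criterion and the theorem. -/

open FrobPush

/-- Fedder's criterion in a fixed degree: multiplication by `a` carries `(I^[p^e] : I)` into
`(J^[p^e] : J)` if and only if all functionals on `F^e_* (S ⧸ I)` map `F^e_* (a J)` into `J`. -/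
theorem forall_apply_mem_map_iff_span_mul_colon_le {p : ℕ} {S : Type*} [CommRing S] [Fact p.Prime]
    [CharP S p] [IsRegularRing S] (hS : IsFFinite p S) {I J : Ideal S} [CharP (S ⧸ I) p]
    (hIJ : I ≤ J) (e : ℕ) (a : S) :
    (∀ φ : FrobPush p e (S ⧸ I) →ₗ[S ⧸ I] S ⧸ I, ∀ x ∈ J.map (Ideal.Quotient.mk I),
      φ (of p e (Ideal.Quotient.mk I a * x)) ∈ J.map (Ideal.Quotient.mk I)) ↔
    Ideal.span {a} * (frobPower p e I).colon (I : Set S) ≤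
      (frobPower p e J).colon (J : Set S) := by
  have := hS.finite_frobPush e
  have := IsRegularRing.projective_frobPush (p := p) (S := S) e
  have hmem (y : S) : Ideal.Quotient.mk I y ∈ J.map (Ideal.Quotient.mk I) ↔ y ∈ J := by
    rw [← Ideal.mem_comap, Ideal.comap_map_of_surjective' _ Ideal.Quotient.mk_surjective,
      Ideal.mk_ker, sup_eq_left.mpr hIJ]
  constructor
  · intro h
    refine Ideal.span_singleton_mul_le_iff.mpr fun s hs ↦ Submodule.mem_colon.mpr fun j hj ↦ ?_
    rw [Submodule.mem_colon] at hs
    refine mem_frobPower_of_forall_apply_mem fun ψ ↦ ?_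
    obtain ⟨φ, hφ⟩ := exists_desc_quotient (I := I) (mulForm ψ (of p e s)) fun i hi ↦
      apply_mem_of_mem_frobPower ψ (hs i hi)
    have h1 := h φ _ ((hmem j).mpr hj)
    rw [← map_mul, hφ, hmem, mulForm_apply, ← map_mul] at h1
    convert! h1 using 3
    rw [smul_eq_mul]; ring
  · intro h φ x hx
    obtain ⟨j, rfl⟩ := Ideal.Quotient.mk_surjective x
    rw [hmem] at hx
    obtain ⟨ψ, hψ⟩ := exists_lift_quotient φ
    rw [← map_mul, ← hψ, hmem]
    have hψI : ∀ i ∈ I, ψ (of p e i) ∈ I := fun i hi ↦ by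
      rw [← Ideal.Quotient.eq_zero_iff_mem, hψ, Ideal.Quotient.eq_zero_iff_mem.mpr hi, map_zero,
        map_zero]
    -- K collects the multipliers t for which ψ(t a J) ⊆ J; the claim is 1 ∈ K, checked at each
    -- maximal ideal.
    let K : Ideal S :=
      { carrier := {t | ∀ j ∈ J, ψ (of p e (t * (a * j))) ∈ J}
        add_mem' := fun hs ht j hj ↦ by
          rw [add_mul, map_add, map_add]; exact Ideal.add_mem _ (hs j hj) (ht j hj)
        zero_mem' := fun j _ ↦ by simp
        smul_mem' := fun c t ht j hj ↦ by
          convert! ht (c * j) (Ideal.mul_mem_left _ _ hj) using 3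
          rw [smul_eq_mul]; ring }
    suffices hK : K = ⊤ by simpa using (Ideal.eq_top_iff_one _).mp hK j hx
    by_contra hK
    obtain ⟨m, hm, hKm⟩ := Ideal.exists_le_maximal K hK
    obtain ⟨r, hr, Φ, hΦ⟩ := exists_smul_eq_mulForm (p := p) (e := e) m
    obtain ⟨b, hb⟩ := hΦ ψ
    have hψr (x : S) : ψ (of p e (r ^ p ^ e * x)) = r * ψ (of p e x) := by
      rw [← smul_of, map_smul, smul_eq_mul]
    -- If rχ = Φ(c·), then χ(r^q b i) = Φ(cbi) = rψ(ci), which lies in I because ψ preserves I.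
    have hcolon : r ^ p ^ e * b ∈ (frobPower p e I).colon (I : Set S) := by
      refine Submodule.mem_colon.mpr fun i hi ↦ mem_frobPower_of_forall_apply_mem fun χ ↦ ?_
      obtain ⟨c, hc⟩ := hΦ χ
      have : χ (of p e ((r ^ p ^ e * b) • i)) = r * ψ (of p e (c * i)) := by
        rw [hb, smul_eq_mul, mul_assoc, ← smul_of, map_smul, smul_eq_mul, hc]
        congr 2; ring
      rw [this]
      exact Ideal.mul_mem_left _ _ (hψI _ (Ideal.mul_mem_left _ _ hi))
    have hJ := Ideal.span_singleton_mul_le_iff.mp h _ hcolon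
    rw [Submodule.mem_colon] at hJ
    -- One factor r^q turns ψ into Φ(b·); the other places r^q b in the colon ideal.
    have hrK : r ^ p ^ e * r ^ p ^ e ∈ K := fun j hj ↦ by
      rw [mul_assoc, hψr, hb]
      have h1 := apply_mem_of_mem_frobPower Φ (hJ j hj)
      convert! h1 using 3
      rw [smul_eq_mul]; ring
    exact hr (hm.isPrime.mem_of_pow_mem _ ((hm.isPrime.mem_or_mem (hKm hrK)).elim id id))

theorem mainTheorem4 {S : Type*} [CommRing S] (p : ℕ) [Fact p.Prime] [CharP S p]
    [IsRegularRing S] (hS : IsFFinite p S)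
    (I : Ideal S) [CharP (S ⧸ I) p]
    (𝔞 : GradedSystem S) (h𝔞 : 𝔞.IsPair) (h𝔞I : (𝔞.map (Ideal.Quotient.mk I)).IsPair)
    (J : Ideal S) (hIJ : I ≤ J) :
    (IsUniformlyFCompatible p (𝔞.map (Ideal.Quotient.mk I)) (J.map (Ideal.Quotient.mk I)) ↔
      ∀ e : ℕ, ∀ a ∈ 𝔞.ideal (p ^ e - 1),
        Ideal.span {a} * (frobPower p e I).colon (I : Set S) ≤
          (frobPower p e J).colon (J : Set S)) ∧
    (IsUniformlyFCompatible p (𝔞.map (Ideal.Quotient.mk I)) (J.map (Ideal.Quotient.mk I)) ↔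
      ∀ e : ℕ,
        𝔞.ideal (p ^ e - 1) * (frobPower p e I).colon (I : Set S) ≤
          (frobPower p e J).colon (J : Set S)) := by
  have h1 : IsUniformlyFCompatible p (𝔞.map (Ideal.Quotient.mk I))
      (J.map (Ideal.Quotient.mk I)) ↔ ∀ e : ℕ, ∀ a ∈ 𝔞.ideal (p ^ e - 1),
        Ideal.span {a} * (frobPower p e I).colon (I : Set S) ≤
          (frobPower p e J).colon (J : Set S) := by
    constructor
    · intro h e a ha
      obtain rfl | he := Nat.eq_zero_or_pos e
      -- Compatibility says nothing for e = 0, but there the right-hand side is (J : J) = S.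
      · intro s _
        rw [frobPower_zero]
        exact Submodule.mem_colon.mpr fun j hj ↦ Ideal.mul_mem_left _ _ hj
      · exact (forall_apply_mem_map_iff_span_mul_colon_le hS hIJ e a).mp
          (h e he _ (Ideal.mem_map_of_mem _ ha))
    · intro h e _ a ha
      obtain ⟨c, hc, rfl⟩ := (Ideal.mem_map_iff_of_surjective _ Ideal.Quotient.mk_surjective).mp ha
      exact (forall_apply_mem_map_iff_span_mul_colon_le hS hIJ e c).mpr (h e c hc)
  refine ⟨h1, h1.trans (forall_congr' fun e ↦ ?_)⟩
  rw [Ideal.mul_le]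
  exact forall₂_congr fun a _ ↦ Ideal.span_singleton_mul_le_iff
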